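/- Let $(M,g)$ be a smooth Riemannian manifold of dimension $n$ (without boundary). A function $f:M\to\mathbb R$ of class $C^2$ is called a metric function if the length $|\operatorname{grad} f|$ of its gradient is constant on every connected component of every level set of $f$. A gradient line of $f$ is a trajectory of $\dot x=\operatorname{grad} f(x)$, that is, a curve $\gamma:J\to M$ on an open interval $J\subseteq\mathbb R$ with $\dot\gamma(t)=\operatorname{grad} f(\gamma(t))$ for all $t\in J$. Let $f:M\to\mathbb R$ be a metric function. Then every gradient line $\gamma:J\to M$ of $f$ is, up to parametrization, a geodesic of $(M,g)$: there are an open interval $J'\subseteq\mathbb R$, a $C^2$ bijection $\varphi:J\to J'$ with $\varphi'>0$, and a geodesic $c:J'\to M$ of the Levi-Civita connection of $g$ (that is, $\nabla_{\dot c}\dot c=0$; a constant curve counts as a geodesic, which concerns only gradient lines consisting of a single critical point of $f$) such that $\gamma=c\circ\varphi$. In particular, in the Euclidean case $M=\mathbb R^n$ with its standard metric, every gradient line of a metric function $f:\mathbb R^n\to\mathbb R$ that is not reduced to a point has curvature $|T'|/|\dot\gamma|$, $T=\dot\gamma/|\dot\gamma|$, equal to zero at each of its points. -/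

import Mathlib

universe u

open Set Bundle
open scoped Manifold ContDiff Bundle InnerProductSpace

-- So that the charted space structure on Euclidean space is found as `chartedSpaceSelf`, and not
-- wrapped in a definitionally equal instance for `TopCat.of`.
attribute [-instance] TopCat.of.chartedSpace TopCat.of.hasGroupoid

noncomputable section

/-- The tangent spaces of an `n`-dimensional Riemannian manifold are complete (they are
finite-dimensional). -/
instance tangentSpace_completeSpace {n : ℕ} {M : Type u} [TopologicalSpace M]
    [ChartedSpace (EuclideanSpace ℝ (Fin n)) M]
    [RiemannianBundle (fun x : M ↦ TangentSpace (𝓡 n) x)] (x : M) :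
    CompleteSpace (TangentSpace (𝓡 n) x) :=
  haveI : FiniteDimensional ℝ (TangentSpace (𝓡 n) x) :=
    inferInstanceAs (FiniteDimensional ℝ (EuclideanSpace ℝ (Fin n)))
  FiniteDimensional.complete ℝ (TangentSpace (𝓡 n) x)

section Manifold

variable (n : ℕ) {M : Type u} [TopologicalSpace M] [ChartedSpace (EuclideanSpace ℝ (Fin n)) M]
  [RiemannianBundle (fun x : M ↦ TangentSpace (𝓡 n) x)]

/-- The Riemannian gradient: the tangent vector `grad f x` with `⟪grad f x, v⟫ = df_x v`. -/
def riemannianGradient (f : M → ℝ) (x : M) : TangentSpace (𝓡 n) x :=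
  (InnerProductSpace.toDual ℝ (TangentSpace (𝓡 n) x)).symm (mvfderiv (𝓡 n) f x)

/-- A metric function: a function of class `C^2` whose gradient has constant length on each
connected component of each of its level sets. -/
structure IsMetricFunction (f : M → ℝ) : Prop where
  contMDiff : ContMDiff (𝓡 n) 𝓘(ℝ, ℝ) 2 f
  norm_gradient_eq : ∀ x y : M, y ∈ connectedComponentIn (f ⁻¹' {f x}) x →
    ‖riemannianGradient n f y‖ = ‖riemannianGradient n f x‖

/-- `γ` is a gradient line of `f` on the open interval `J`: `γ' = grad f (γ)` on `J`. -/
structure IsGradientLineOn (f : M → ℝ) (γ : ℝ → M) (J : Set ℝ) : Prop where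
  isOpen : IsOpen J
  ordConnected : J.OrdConnected
  isMIntegralCurveOn : IsMIntegralCurveOn (I := 𝓡 n) γ (riemannianGradient n f) J

/-- The coordinate vector field `∂_i` of the chart around `x₀`, at the point with coordinates
`y`. -/
def coordVector (x₀ : M) (i : Fin n) (y : EuclideanSpace ℝ (Fin n)) :
    TangentSpace (𝓡 n) ((extChartAt (𝓡 n) x₀).symm y) :=
  mfderiv (𝓡 n) (𝓡 n) (extChartAt (𝓡 n) x₀).symm y (EuclideanSpace.single i (1 : ℝ))

/-- The matrix `g_{ij} = ⟪∂_i, ∂_j⟫` of the metric in the chart around `x₀`. -/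
def metricMatrix (x₀ : M) (y : EuclideanSpace ℝ (Fin n)) : Matrix (Fin n) (Fin n) ℝ :=
  Matrix.of fun i j ↦ ⟪coordVector n x₀ i y, coordVector n x₀ j y⟫_ℝ

/-- The partial derivative `∂_l g_{ij}` in the chart around `x₀`. -/
def metricPartial (x₀ : M) (l i j : Fin n) (y : EuclideanSpace ℝ (Fin n)) : ℝ :=
  fderiv ℝ (fun z ↦ metricMatrix n x₀ z i j) y (EuclideanSpace.single l (1 : ℝ))

/-- The Christoffel symbols of the Levi-Civita connection in the chart around `x₀`,
`Γ^k_{ij} = 1/2 ∑_l g^{kl} (∂_i g_{jl} + ∂_j g_{il} - ∂_l g_{ij})`. -/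
def christoffel (x₀ : M) (k i j : Fin n) (y : EuclideanSpace ℝ (Fin n)) : ℝ :=
  (1 / 2 : ℝ) * ∑ l, (metricMatrix n x₀ y)⁻¹ k l *
    (metricPartial n x₀ i j l y + metricPartial n x₀ j i l y - metricPartial n x₀ l i j y)

/-- The coordinates of the point `c t` in the chart around `x₀`. -/
def coords (x₀ : M) (c : ℝ → M) (k : Fin n) (t : ℝ) : ℝ :=
  extChartAt (𝓡 n) x₀ (c t) k

/-- `c` is an (affinely parametrized) geodesic on the open interval `J`: it is of class `C^2` there
and satisfies `(c^k)'' + ∑_{i,j} Γ^k_{ij} (c^i)' (c^j)' = 0` in every chart. Constant curves are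
included. -/
structure IsGeodesicOn (c : ℝ → M) (J : Set ℝ) : Prop where
  isOpen : IsOpen J
  ordConnected : J.OrdConnected
  contMDiffOn : ContMDiffOn 𝓘(ℝ, ℝ) (𝓡 n) 2 c J
  geodesic_eq : ∀ x₀ : M, ∀ t ∈ J, c t ∈ (extChartAt (𝓡 n) x₀).source → ∀ k : Fin n,
    deriv (deriv (coords n x₀ c k)) t +
      ∑ i, ∑ j, christoffel n x₀ k i j (extChartAt (𝓡 n) x₀ (c t)) *
        deriv (coords n x₀ c i) t * deriv (coords n x₀ c j) t = 0

/-- The curve `γ` on the interval `J` is a geodesic line: after an orientation preserving `C^2`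
change of parameter `φ : J → J'` with nowhere vanishing derivative it is a geodesic `c` on the
open interval `J'`. -/
def IsGeodesicLineOn (γ : ℝ → M) (J : Set ℝ) : Prop :=
  ∃ (c : ℝ → M) (J' : Set ℝ) (φ : ℝ → ℝ), IsGeodesicOn n c J' ∧
    ContDiffOn ℝ 2 φ J ∧ (∀ t ∈ J, 0 < deriv φ t) ∧ BijOn φ J J' ∧ ∀ t ∈ J, γ t = c (φ t)

end Manifold

/-- The curvature `|dT/ds| = |T'(t)| / |γ'(t)|` of a curve in Euclidean space, where
`T = γ' / |γ'|` is the unit tangent vector (meaningful where `γ` is `C^2` and `γ' ≠ 0`). -/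
def euclideanCurvature {n : ℕ} (γ : ℝ → EuclideanSpace ℝ (Fin n)) (t : ℝ) : ℝ :=
  ‖deriv (fun s ↦ ‖deriv γ s‖⁻¹ • deriv γ s) t‖ / ‖deriv γ t‖

end

open Filter Topology in
/-- A tangent vector to a regular level set is the velocity of a curve in that level set. -/
theorem HasStrictFDerivAt.exists_curve_in_level {E : Type*} [NormedAddCommGroup E]
    [NormedSpace ℝ E] [CompleteSpace E] {F : E → ℝ} {F' : E →L[ℝ] ℝ} {a : E}
    (hF : HasStrictFDerivAt F F' a) (hF' : F' ≠ 0) {U : Set E} (hU : U ∈ 𝓝 a) {v : E}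
    (hv : F' v = 0) :
    ∃ δ > 0, ∃ c : ℝ → E, ContinuousOn c (Metric.ball 0 δ) ∧ c 0 = a ∧ HasDerivAt c v 0 ∧
      ∀ s ∈ Metric.ball (0 : ℝ) δ, F (c s) = F a ∧ c s ∈ U := by
  have hsurj : F'.range = ⊤ := LinearMap.range_eq_top.2
    (LinearMap.surjective (f := F'.toLinearMap) fun h ↦ hF' (by ext v; exact LinearMap.congr_fun h v))
  set e := hF.implicitToOpenPartialHomeomorph F F' hsurj with he
  let vk : F'.ker := ⟨v, hv⟩
  let l : ℝ → ℝ × F'.ker := fun s ↦ (F a, s • vk)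
  have hl : Continuous l := by fun_prop
  have hl0 : l 0 = (F a, 0) := by simp [l]
  have hea : e a = (F a, 0) := hF.implicitToOpenPartialHomeomorph_self hsurj
  have hmem : (F a, (0 : F'.ker)) ∈ e.target :=
    hF.mem_implicitToOpenPartialHomeomorph_target hsurj
  have hsymm : e.symm (F a, 0) = a := by
    rw [← hea, e.left_inv (hF.mem_implicitToOpenPartialHomeomorph_source hsurj)]
  have hev : ∀ᶠ s in 𝓝 (0 : ℝ), l s ∈ e.target ∧ e.symm (l s) ∈ U := by
    have h1 : ∀ᶠ p in 𝓝 (F a, (0 : F'.ker)), p ∈ e.target := e.open_target.mem_nhds hmem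
    have h2 : ∀ᶠ p in 𝓝 (F a, (0 : F'.ker)), e.symm p ∈ U := by
      have := e.symm.continuousAt (x := (F a, (0 : F'.ker))) hmem
      rw [ContinuousAt, hsymm] at this
      exact this hU
    have := hl.tendsto 0
    rw [hl0] at this
    exact this.eventually (h1.and h2)
  obtain ⟨δ, hδ, hball⟩ := Metric.eventually_nhds_iff_ball.1 hev
  refine ⟨δ, hδ, fun s ↦ e.symm (l s), ?_, ?_, ?_, ?_⟩
  · exact e.symm.continuousOn.comp hl.continuousOn fun s hs ↦ (hball s hs).1
  · simp only [hl0, hsymm]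
  · have h := (hF.to_implicitFunction hsurj).hasFDerivAt
    have hs : HasDerivAt (fun s : ℝ ↦ s • vk) vk 0 := by
      simpa using (hasDerivAt_id (0 : ℝ)).smul_const vk
    have h' : HasFDerivAt (HasStrictFDerivAt.implicitFunction F F' hF hsurj (F a))
      F'.ker.subtypeL ((fun s : ℝ ↦ s • vk) 0) := by simpa using h
    exact h'.comp_hasDerivAt 0 hs
  · intro s hs
    refine ⟨?_, (hball s hs).2⟩
    have h := hF.implicitToOpenPartialHomeomorph_fst hsurj (e.symm (l s))
    rw [← he, e.right_inv (hball s hs).1] at h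
    exact h.symm

theorem ContinuousLinearMap.eq_smul_of_ker_le {E : Type*} [NormedAddCommGroup E]
    [NormedSpace ℝ E] {A B : E →L[ℝ] ℝ} (hA : A ≠ 0) (h : ∀ v, A v = 0 → B v = 0) :
    ∃ r : ℝ, B = r • A := by
  obtain ⟨x, hx⟩ : ∃ x, A x ≠ 0 := by
    by_contra! hc
    exact hA (by ext; simp [hc])
  refine ⟨B x / A x, ?_⟩
  ext v
  have := h (v - (A v / A x) • x) (by simp; field_simp; ring)
  simp at this ⊢
  field_simp at this ⊢
  linarith

/-- The algebra behind `∇_X X = grad |X|² / 2` for a gradient field `X`, at one point and in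
coordinates: `a m i j` stands for `∂_m g_{ij}`, `D m k` for `∂_m X^k` and `H` for the matrix of
second derivatives of the potential. -/
theorem gradient_acceleration_algebra {n : ℕ} (g : Matrix (Fin n) (Fin n) ℝ)
    (hdet : IsUnit g.det) (hg : ∀ i j, g i j = g j i) (a : Fin n → Fin n → Fin n → ℝ)
    (ha : ∀ m i j, a m i j = a m j i) (X : Fin n → ℝ) (D H : Fin n → Fin n → ℝ)
    (hH : ∀ i j, H i j = H j i)
    (h : ∀ m l, ∑ k, (a m l k * X k + g l k * D m k) = H m l) (k : Fin n) :
    ∑ m, X m * D m k + ∑ i, ∑ j, ((1 / 2 : ℝ) * ∑ l, g⁻¹ k l *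
      (a i j l + a j i l - a l i j)) * X i * X j =
    (1 / 2 : ℝ) * ∑ l, g⁻¹ k l * ∑ i, ∑ j,
      (a l i j * X i * X j + g i j * (D l i * X j + X i * D l j)) := by
  have key : ∀ l, ∑ p, g l p * ∑ m, X m * D m p + (1 / 2 : ℝ) * ∑ i, ∑ j,
      (a i j l + a j i l - a l i j) * X i * X j = (1 / 2 : ℝ) * ∑ i, ∑ j,
      (a l i j * X i * X j + g i j * (D l i * X j + X i * D l j)) := by
    intro l
    have e1 : ∑ p, g l p * ∑ m, X m * D m p =
        ∑ m, X m * H m l - ∑ i, ∑ j, a i l j * X i * X j := by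
      simp_rw [← h, Finset.mul_sum, ← Finset.sum_sub_distrib]
      rw [Finset.sum_comm]
      refine Finset.sum_congr rfl fun i _ ↦ Finset.sum_congr rfl fun j _ ↦ by ring
    have e2 : ∑ i, ∑ j, g i j * (X i * D l j) =
        ∑ m, X m * H m l - ∑ i, ∑ j, a l i j * X i * X j := by
      simp_rw [hH _ l, ← h, Finset.mul_sum, ← Finset.sum_sub_distrib]
      refine Finset.sum_congr rfl fun i _ ↦ Finset.sum_congr rfl fun j _ ↦ by ring
    have e3 : ∑ i, ∑ j, g i j * (D l i * X j) = ∑ i, ∑ j, g i j * (X i * D l j) := by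
      rw [Finset.sum_comm]
      refine Finset.sum_congr rfl fun i _ ↦ Finset.sum_congr rfl fun j _ ↦ ?_
      rw [hg j i]; ring
    have e4 : ∑ i, ∑ j, (a i j l + a j i l - a l i j) * X i * X j =
        2 * ∑ i, ∑ j, a i l j * X i * X j - ∑ i, ∑ j, a l i j * X i * X j := by
      have : ∑ i, ∑ j, a j i l * X i * X j = ∑ i, ∑ j, a i l j * X i * X j := by
        rw [Finset.sum_comm]
        refine Finset.sum_congr rfl fun i _ ↦ Finset.sum_congr rfl fun j _ ↦ ?_
        rw [ha i j l]; ring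
      simp_rw [sub_mul, add_mul, Finset.sum_sub_distrib, Finset.sum_add_distrib, this,
        ha _ _ l]
      ring
    simp_rw [mul_add, Finset.sum_add_distrib, e3, e2, e4, e1]
    ring
  have hinv : ∀ v : Fin n → ℝ, ∑ l, g⁻¹ k l * ∑ p, g l p * v p = v k := by
    intro v
    have : (g⁻¹.mulVec (g.mulVec v)) k = v k := by
      rw [Matrix.mulVec_mulVec, Matrix.nonsing_inv_mul g hdet, Matrix.one_mulVec]
    simpa [Matrix.mulVec, dotProduct] using this
  rw [Finset.mul_sum]
  have e5 : ∀ l, (1 / 2 : ℝ) * (g⁻¹ k l * ∑ i, ∑ j,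
      (a l i j * X i * X j + g i j * (D l i * X j + X i * D l j))) =
      g⁻¹ k l * ∑ p, g l p * ∑ m, X m * D m p + g⁻¹ k l * ((1 / 2 : ℝ) * ∑ i, ∑ j,
      (a i j l + a j i l - a l i j) * X i * X j) := by
    intro l
    rw [← mul_add, key]; ring
  simp_rw [e5, Finset.sum_add_distrib, hinv (fun p ↦ ∑ m, X m * D m p)]
  congr 1
  simp_rw [Finset.mul_sum, Finset.sum_mul]
  have : ∀ A : Fin n → Fin n → Fin n → ℝ,
      ∑ i, ∑ j, ∑ l, A i j l = ∑ l, ∑ i, ∑ j, A i j l := by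
    intro A
    exact (Finset.sum_congr rfl fun i _ ↦ Finset.sum_comm).trans Finset.sum_comm
  rw [this]
  refine Finset.sum_congr rfl fun l _ ↦ Finset.sum_congr rfl fun i _ ↦
    Finset.sum_congr rfl fun j _ ↦ by ring

theorem ContDiffOn.matrix_det {E : Type*} [NormedAddCommGroup E] [NormedSpace ℝ E] {ι : Type*}
    [Fintype ι] [DecidableEq ι] {m : WithTop ℕ∞} {U : Set E} {g : E → Matrix ι ι ℝ}
    (hg : ∀ i j, ContDiffOn ℝ m (fun y ↦ g y i j) U) : ContDiffOn ℝ m (fun y ↦ (g y).det) U := by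
  simp only [Matrix.det_apply']
  exact ContDiffOn.sum fun σ _ ↦ contDiffOn_const.mul (contDiffOn_prod fun i _ ↦ hg _ _)

theorem ContDiffOn.matrix_inv_apply {E : Type*} [NormedAddCommGroup E] [NormedSpace ℝ E]
    {ι : Type*} [Fintype ι] [DecidableEq ι] {m : WithTop ℕ∞} {U : Set E} {g : E → Matrix ι ι ℝ}
    (hg : ∀ i j, ContDiffOn ℝ m (fun y ↦ g y i j) U) (hdet : ∀ y ∈ U, IsUnit (g y).det)
    (i j : ι) : ContDiffOn ℝ m (fun y ↦ (g y)⁻¹ i j) U := by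
  simp only [Matrix.inv_def, Ring.inverse_eq_inv', Matrix.smul_apply, smul_eq_mul,
    Matrix.adjugate_apply]
  refine ((ContDiffOn.matrix_det hg).inv fun y hy ↦ (hdet y hy).ne_zero).mul
    (ContDiffOn.matrix_det fun k l ↦ ?_)
  by_cases hk : k = j
  · subst hk
    simpa using contDiffOn_const
  · simpa [Matrix.updateRow_ne hk] using hg k l

open Filter Topology in
/-- In coordinates, an integral curve of the gradient `X` of `F` for the metric `g` has covariant
acceleration `(r / 2) X`, where `d(|X|²) = r dF`. -/
theorem gradient_acceleration {n : ℕ} {U : Set (EuclideanSpace ℝ (Fin n))} (hU : IsOpen U)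
    {F W : EuclideanSpace ℝ (Fin n) → ℝ} (hF : ContDiffOn ℝ 2 F U)
    {g : EuclideanSpace ℝ (Fin n) → Matrix (Fin n) (Fin n) ℝ}
    (hg : ∀ i j, ContDiffOn ℝ 1 (fun y ↦ g y i j) U) (hsymm : ∀ y i j, g y i j = g y j i)
    (hdet : ∀ y ∈ U, IsUnit (g y).det)
    {X : EuclideanSpace ℝ (Fin n) → EuclideanSpace ℝ (Fin n)} (hX : ContDiffOn ℝ 1 X U)
    (hgX : ∀ y ∈ U, ∀ l, ∑ k, g y l k * X y k = fderiv ℝ F y (EuclideanSpace.single l (1 : ℝ)))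
    (hW : ∀ y ∈ U, W y = ∑ i, ∑ j, g y i j * (X y i * X y j))
    {x : ℝ → EuclideanSpace ℝ (Fin n)} {t₀ : ℝ} (hx : ∀ᶠ t in 𝓝 t₀, HasDerivAt x (X (x t)) t)
    (hx₀ : x t₀ ∈ U) {r : ℝ} (hr : fderiv ℝ W (x t₀) = r • fderiv ℝ F (x t₀)) (k : Fin n) :
    deriv (deriv fun t ↦ x t k) t₀ + ∑ i, ∑ j, ((1 / 2 : ℝ) * ∑ l, (g (x t₀))⁻¹ k l *
      (fderiv ℝ (fun z ↦ g z j l) (x t₀) (EuclideanSpace.single i (1 : ℝ)) +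
        fderiv ℝ (fun z ↦ g z i l) (x t₀) (EuclideanSpace.single j (1 : ℝ)) -
        fderiv ℝ (fun z ↦ g z i j) (x t₀) (EuclideanSpace.single l (1 : ℝ)))) *
      deriv (fun t ↦ x t i) t₀ * deriv (fun t ↦ x t j) t₀ =
    r / 2 * deriv (fun t ↦ x t k) t₀ := by
  set p := x t₀ with hp
  have hUp : U ∈ 𝓝 p := hU.mem_nhds hx₀
  let e : Fin n → EuclideanSpace ℝ (Fin n) := fun l ↦ EuclideanSpace.single l (1 : ℝ)
  have hcoord : ∀ i, ∀ {z : ℝ → EuclideanSpace ℝ (Fin n)} {z' : EuclideanSpace ℝ (Fin n)} {t : ℝ},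
      HasDerivAt z z' t → HasDerivAt (fun t ↦ z t i) (z' i) t := fun i z z' t h ↦
    (EuclideanSpace.proj (𝕜 := ℝ) i).hasFDerivAt.comp_hasDerivAt t h
  have hderiv : ∀ i, deriv (fun t ↦ x t i) =ᶠ[𝓝 t₀] fun t ↦ X (x t) i := fun i ↦ by
    filter_upwards [hx] with t ht
    exact (hcoord i ht).deriv
  have hXp : DifferentiableAt ℝ X p := (hX.contDiffAt hUp).differentiableAt one_ne_zero
  have hXi : ∀ i, HasFDerivAt (fun z ↦ X z i)
      ((EuclideanSpace.proj (𝕜 := ℝ) i).comp (fderiv ℝ X p)) p := fun i ↦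
    (EuclideanSpace.proj (𝕜 := ℝ) i).hasFDerivAt.comp p hXp.hasFDerivAt
  have hgp : ∀ i j, DifferentiableAt ℝ (fun z ↦ g z i j) p := fun i j ↦
    ((hg i j).contDiffAt hUp).differentiableAt one_ne_zero
  let a : Fin n → Fin n → Fin n → ℝ := fun m i j ↦ fderiv ℝ (fun z ↦ g z i j) p (e m)
  let D : Fin n → Fin n → ℝ := fun m k ↦ fderiv ℝ X p (e m) k
  let H : Fin n → Fin n → ℝ := fun m l ↦ fderiv ℝ (fderiv ℝ F) p (e m) (e l)
  have hFp : ContDiffAt ℝ 2 F p := hF.contDiffAt hUp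
  have hH : ∀ i j, H i j = H j i := fun i j ↦
    (hFp.isSymmSndFDerivAt (by simp)).eq (e i) (e j)
  have hdF : DifferentiableAt ℝ (fderiv ℝ F) p :=
    (hFp.fderiv_right (m := 1) (by norm_num)).differentiableAt one_ne_zero
  have h : ∀ m l, ∑ k, (a m l k * X p k + g p l k * D m k) = H m l := by
    intro m l
    have h1 : HasFDerivAt (fun z ↦ ∑ k, g z l k * X z k) _ p :=
      HasFDerivAt.fun_sum fun k _ ↦ (hgp l k).hasFDerivAt.mul (hXi k)
    have h2 : HasFDerivAt (fun z ↦ fderiv ℝ F z (e l)) ((fderiv ℝ (fderiv ℝ F) p).flip (e l)) p :=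
      ((ContinuousLinearMap.apply ℝ ℝ (e l)).hasFDerivAt.comp p hdF.hasFDerivAt)
    have h3 : (fun z ↦ ∑ k, g z l k * X z k) =ᶠ[𝓝 p] fun z ↦ fderiv ℝ F z (e l) := by
      filter_upwards [hUp] with z hz using hgX z hz l
    have h4 := congrArg (fun A ↦ A (e m)) (h1.unique (h2.congr_of_eventuallyEq h3))
    simp only [sum_apply, add_apply,
      smul_apply, ContinuousLinearMap.comp_apply, smul_eq_mul,
      ContinuousLinearMap.flip_apply] at h4
    rw [show H m l = _ from h4.symm]
    refine Finset.sum_congr rfl fun k _ ↦ ?_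
    simp only [a, D, PiLp.proj_apply]
    ring
  have hWp : ∀ l, fderiv ℝ W p (e l) = ∑ i, ∑ j,
      (a l i j * X p i * X p j + g p i j * (D l i * X p j + X p i * D l j)) := by
    intro l
    have h1 : HasFDerivAt (fun z ↦ ∑ i, ∑ j, g z i j * (X z i * X z j)) _ p :=
      HasFDerivAt.fun_sum fun i _ ↦ HasFDerivAt.fun_sum fun j _ ↦
        (hgp i j).hasFDerivAt.mul ((hXi i).mul (hXi j))
    have h3 : W =ᶠ[𝓝 p] fun z ↦ ∑ i, ∑ j, g z i j * (X z i * X z j) := by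
      filter_upwards [hUp] with z hz using hW z hz
    rw [h3.fderiv_eq, h1.fderiv]
    simp only [sum_apply, add_apply,
      smul_apply, ContinuousLinearMap.comp_apply, smul_eq_mul]
    refine Finset.sum_congr rfl fun i _ ↦ Finset.sum_congr rfl fun j _ ↦ ?_
    simp only [a, D, PiLp.proj_apply]
    ring
  have hacc : deriv (deriv fun t ↦ x t k) t₀ = ∑ m, X p m * D m k := by
    rw [(hderiv k).deriv_eq]
    have h1 : HasDerivAt (fun t ↦ X (x t)) (fderiv ℝ X p (X p)) t₀ :=
      (hp ▸ hXp.hasFDerivAt : HasFDerivAt X (fderiv ℝ X p) (x t₀)).comp_hasDerivAt t₀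
        hx.self_of_nhds
    rw [(hcoord k h1).deriv]
    have h2 : X p = ∑ m, X p m • e m := by
      have := (EuclideanSpace.basisFun (Fin n) ℝ).sum_repr (X p)
      simpa [e] using this.symm
    conv_lhs => rw [h2]
    simp [D]
  have hdx : ∀ i, deriv (fun t ↦ x t i) t₀ = X p i := fun i ↦ (hderiv i).self_of_nhds
  simp only [hacc, hdx]
  rw [gradient_acceleration_algebra (g p) (hdet p hx₀) (hsymm p) a (fun m i j ↦ by
    simp only [a, hsymm _ i j]) (X p) D H hH h k]
  simp only [← hWp, hr, smul_apply, smul_eq_mul, e, ← hgX p hx₀]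
  have : ((g p)⁻¹.mulVec ((g p).mulVec (X p))) k = X p k := by
    rw [Matrix.mulVec_mulVec, Matrix.nonsing_inv_mul _ (hdet p hx₀), Matrix.one_mulVec]
  simp only [Matrix.mulVec, dotProduct] at this
  simp_rw [← this, Finset.mul_sum]
  refine Finset.sum_congr rfl fun i _ ↦ Finset.sum_congr rfl fun j _ ↦ by ring

open Filter Topology in
/-- A `C^1` positive function on an open interval is the derivative of a `C^2` change of
parameter `φ` with `C^2` inverse `ψ`. -/
theorem exists_reparametrization {J : Set ℝ} (hJ : IsOpen J) (hJc : J.OrdConnected) {w : ℝ → ℝ}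
    (hw : ContDiffOn ℝ 1 w J) (hpos : ∀ t ∈ J, 0 < w t) :
    ∃ (φ ψ : ℝ → ℝ) (J' : Set ℝ), IsOpen J' ∧ J'.OrdConnected ∧ BijOn φ J J' ∧ InvOn ψ φ J J' ∧
      (∀ t ∈ J, HasDerivAt φ (w t) t) ∧ ContDiffOn ℝ 2 φ J ∧
      (∀ s ∈ J', HasDerivAt ψ (w (ψ s))⁻¹ s) ∧ ContDiffOn ℝ 2 ψ J' := by
  rcases J.eq_empty_or_nonempty with rfl | ⟨t₀, ht₀⟩
  · exact ⟨id, id, ∅, isOpen_empty, ordConnected_empty, bijOn_empty id, ⟨fun _ _ ↦ rfl, fun _ _ ↦ rfl⟩, by simp, by simp,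
      by simp, by simp⟩
  let φ : ℝ → ℝ := fun t ↦ ∫ s in t₀..t, w s
  have hφ : ∀ t ∈ J, HasDerivAt φ (w t) t := by
    intro t ht
    have hsub : uIcc t₀ t ⊆ J := hJc.uIcc_subset ht₀ ht
    refine intervalIntegral.integral_hasDerivAt_right
      (hw.continuousOn.mono hsub).intervalIntegrable ?_
      (hw.continuousOn.continuousAt (hJ.mem_nhds ht))
    exact (hw.continuousOn.stronglyMeasurableAtFilter hJ t ht)
  have hφc : ContinuousOn φ J := fun t ht ↦ (hφ t ht).continuousAt.continuousWithinAt
  have hmono : StrictMonoOn φ J := by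
    refine strictMonoOn_of_deriv_pos hJc.convex hφc fun t ht ↦ ?_
    have ht' := interior_subset ht
    rw [(hφ t ht').deriv]
    exact hpos t ht'
  have hnhds : ∀ t ∈ J, φ '' J ∈ 𝓝 (φ t) := fun t ht ↦ by
    have hs : HasStrictDerivAt φ (w t) t := by
      refine hasStrictDerivAt_of_hasDerivAt_of_continuousAt ?_
        (hw.continuousOn.continuousAt (hJ.mem_nhds ht))
      filter_upwards [hJ.mem_nhds ht] with s hs using hφ s hs
    have := hs.map_nhds_eq (hpos t ht).ne'
    rw [← this]
    exact image_mem_map (hJ.mem_nhds ht)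
  have hJ' : IsOpen (φ '' J) := isOpen_iff_mem_nhds.2 (by
    rintro _ ⟨t, ht, rfl⟩
    exact hnhds t ht)
  have hJ'c : (φ '' J).OrdConnected :=
    (hJc.isPreconnected.image φ hφc).ordConnected
  let ψ := Function.invFunOn φ J
  have hinv : InvOn ψ φ J (φ '' J) := hmono.injOn.bijOn_image.invOn_invFunOn
  have hψmem : ∀ s ∈ φ '' J, ψ s ∈ J := fun s hs ↦ Function.invFunOn_mem hs
  have hψimg : ψ '' (φ '' J) = J := hinv.1.image_image
  have hψmono : StrictMonoOn ψ (φ '' J) := by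
    rintro _ ⟨a, ha, rfl⟩ _ ⟨b, hb, rfl⟩ hab
    rw [hinv.1 ha, hinv.1 hb]
    exact (hmono.lt_iff_lt ha hb).1 hab
  have hψc : ∀ s ∈ φ '' J, ContinuousAt ψ s := fun s hs ↦
    hψmono.continuousAt_of_image_mem_nhds (hJ'.mem_nhds hs) (by
      rw [hψimg]; exact hJ.mem_nhds (hψmem s hs))
  have hψ : ∀ s ∈ φ '' J, HasDerivAt ψ (w (ψ s))⁻¹ s := fun s hs ↦
    (hφ _ (hψmem s hs)).of_local_left_inverse (hψc s hs) (hpos _ (hψmem s hs)).ne' (by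
      filter_upwards [hJ'.mem_nhds hs] with r hr using hinv.2 hr)
  have hψd : DifferentiableOn ℝ ψ (φ '' J) := fun s hs ↦
    (hψ s hs).differentiableAt.differentiableWithinAt
  have hψ1 : ContDiffOn ℝ 1 ψ (φ '' J) := by
    rw [show (1 : WithTop ℕ∞) = 0 + 1 by simp, contDiffOn_succ_iff_deriv_of_isOpen hJ']
    refine ⟨hψd, by simp, ?_⟩
    rw [contDiffOn_zero]
    refine ContinuousOn.congr (f := fun s ↦ (w (ψ s))⁻¹) ?_ fun s hs ↦ (hψ s hs).deriv
    exact (hw.continuousOn.comp hψd.continuousOn hψmem).inv₀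
      fun s hs ↦ (hpos _ (hψmem s hs)).ne'
  refine ⟨φ, ψ, φ '' J, hJ', hJ'c, hmono.injOn.bijOn_image, hinv, hφ, ?_, hψ, ?_⟩
  · rw [show (2 : WithTop ℕ∞) = 1 + 1 by norm_num, contDiffOn_succ_iff_deriv_of_isOpen hJ]
    exact ⟨fun t ht ↦ (hφ t ht).differentiableAt.differentiableWithinAt, by simp,
      hw.congr fun t ht ↦ (hφ t ht).deriv⟩
  · rw [show (2 : WithTop ℕ∞) = 1 + 1 by norm_num, contDiffOn_succ_iff_deriv_of_isOpen hJ']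
    refine ⟨hψd, by simp, ContDiffOn.congr (f := fun s ↦ (w (ψ s))⁻¹) ?_
      fun s hs ↦ (hψ s hs).deriv⟩
    exact (hw.comp hψ1 hψmem).inv fun s hs ↦ (hpos _ (hψmem s hs)).ne'

section Chart

variable {n : ℕ} {M : Type u} [TopologicalSpace M] [ChartedSpace (EuclideanSpace ℝ (Fin n)) M]

/-- The derivative of the inverse of the chart around `x₀` at the point with coordinates `y`. -/
noncomputable abbrev chartInvDeriv (x₀ : M) (y : EuclideanSpace ℝ (Fin n)) :
    EuclideanSpace ℝ (Fin n) →L[ℝ] TangentSpace (𝓡 n) ((extChartAt (𝓡 n) x₀).symm y) :=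
  mfderiv (𝓡 n) (𝓡 n) (extChartAt (𝓡 n) x₀).symm y

/-- The derivative of the chart around `x₀` at the point with coordinates `y`. -/
noncomputable abbrev chartDeriv (x₀ : M) (y : EuclideanSpace ℝ (Fin n)) :
    TangentSpace (𝓡 n) ((extChartAt (𝓡 n) x₀).symm y) →L[ℝ] EuclideanSpace ℝ (Fin n) :=
  mfderiv (𝓡 n) (𝓡 n) (extChartAt (𝓡 n) x₀) ((extChartAt (𝓡 n) x₀).symm y)

theorem chartDeriv_chartInvDeriv [IsManifold (𝓡 n) ∞ M] {x₀ : M} {y : EuclideanSpace ℝ (Fin n)}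
    (hy : y ∈ (extChartAt (𝓡 n) x₀).target) (v : EuclideanSpace ℝ (Fin n)) :
    chartDeriv x₀ y (chartInvDeriv x₀ y v) = v := by
  have : IsManifold (𝓡 n) 1 M := IsManifold.of_le (n := ∞) (by norm_num)
  have := mfderiv_extChartAt_comp_mfderivWithin_extChartAt_symm (I := 𝓡 n) hy
  simp only [modelWithCornersSelf_coe, range_id, mfderivWithin_univ] at this
  exact congrArg (fun A ↦ A v) this

theorem chartInvDeriv_chartDeriv [IsManifold (𝓡 n) ∞ M] {x₀ : M} {y : EuclideanSpace ℝ (Fin n)}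
    (hy : y ∈ (extChartAt (𝓡 n) x₀).target)
    (v : TangentSpace (𝓡 n) ((extChartAt (𝓡 n) x₀).symm y)) :
    chartInvDeriv x₀ y (chartDeriv x₀ y v) = v := by
  have : IsManifold (𝓡 n) 1 M := IsManifold.of_le (n := ∞) (by norm_num)
  have := mfderivWithin_extChartAt_symm_comp_mfderiv_extChartAt (I := 𝓡 n) hy
  simp only [modelWithCornersSelf_coe, range_id, mfderivWithin_univ] at this
  exact congrArg (fun A ↦ A v) this

variable [RiemannianBundle (fun x : M ↦ TangentSpace (𝓡 n) x)]

theorem inner_chartInvDeriv (x₀ : M) (y u v : EuclideanSpace ℝ (Fin n)) :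
    ⟪chartInvDeriv x₀ y u, chartInvDeriv x₀ y v⟫_ℝ =
      ∑ i, ∑ j, metricMatrix n x₀ y i j * (u i * v j) := by
  have h : ∀ u : EuclideanSpace ℝ (Fin n),
      chartInvDeriv x₀ y u = ∑ i, u i • coordVector n x₀ i y := by
    intro u
    have hu : u = ∑ m, u m • EuclideanSpace.single m (1 : ℝ) := by
      simpa using ((EuclideanSpace.basisFun (Fin n) ℝ).sum_repr u).symm
    conv_lhs => rw [hu]
    rw [map_sum]
    simp_rw [map_smul]
    rfl
  rw [h u, h v, sum_inner]
  simp_rw [inner_sum, real_inner_smul_left, real_inner_smul_right]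
  refine Finset.sum_congr rfl fun i _ ↦ Finset.sum_congr rfl fun j _ ↦ ?_
  simp only [metricMatrix, Matrix.of_apply]
  ring

theorem metricMatrix_symm (x₀ : M) (y : EuclideanSpace ℝ (Fin n)) (i j : Fin n) :
    metricMatrix n x₀ y i j = metricMatrix n x₀ y j i := by
  simp only [metricMatrix, Matrix.of_apply]
  exact real_inner_comm _ _

variable [IsManifold (𝓡 n) ∞ M]

theorem isUnit_det_metricMatrix {x₀ : M} {y : EuclideanSpace ℝ (Fin n)}
    (hy : y ∈ (extChartAt (𝓡 n) x₀).target) : IsUnit (metricMatrix n x₀ y).det := by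
  rw [isUnit_iff_ne_zero]
  intro h0
  obtain ⟨v, hv, hgv⟩ := Matrix.exists_mulVec_eq_zero_iff.2 h0
  let w : EuclideanSpace ℝ (Fin n) := WithLp.toLp 2 v
  have h1 : ⟪chartInvDeriv x₀ y w, chartInvDeriv x₀ y w⟫_ℝ = 0 := by
    rw [inner_chartInvDeriv]
    refine Finset.sum_eq_zero fun i _ ↦ ?_
    have := congrFun hgv i
    simp only [Matrix.mulVec, dotProduct, Pi.zero_apply] at this
    calc ∑ j, metricMatrix n x₀ y i j * (w i * w j)
        = v i * ∑ j, metricMatrix n x₀ y i j * v j := by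
          rw [Finset.mul_sum]
          exact Finset.sum_congr rfl fun j _ ↦ by simp only [w]; ring
      _ = 0 := by rw [this, mul_zero]
  have h2 := inner_self_eq_zero.1 h1
  have h3 := chartDeriv_chartInvDeriv hy w
  rw [h2, map_zero] at h3
  exact hv (by simpa [w] using h3.symm)

theorem contDiffOn_metricMatrix
    [IsContMDiffRiemannianBundle (𝓡 n) ∞ (EuclideanSpace ℝ (Fin n))
      (fun x : M ↦ TangentSpace (𝓡 n) x)] (x₀ : M) (i j : Fin n) :
    ContDiffOn ℝ 1 (fun y ↦ metricMatrix n x₀ y i j) (extChartAt (𝓡 n) x₀).target := by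
  have : IsManifold (𝓡 n) 1 M := IsManifold.of_le (n := ∞) (by norm_num)
  have : IsContMDiffRiemannianBundle (𝓡 n) 1 (EuclideanSpace ℝ (Fin n))
    (fun x : M ↦ TangentSpace (𝓡 n) x) := IsContMDiffRiemannianBundle.of_le (n := ∞) (by norm_num)
  have hopen : IsOpen (extChartAt (𝓡 n) x₀).target := isOpen_extChartAt_target x₀
  have hsec : ∀ l : Fin n, ContMDiffOn (𝓡 n) (𝓡 n).tangent 1
      (fun y ↦ (⟨(extChartAt (𝓡 n) x₀).symm y, coordVector n x₀ l y⟩ : TangentBundle (𝓡 n) M))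
      (extChartAt (𝓡 n) x₀).target := by
    intro l
    have h1 : ContMDiffOn (𝓡 n) (𝓡 n) ∞ (extChartAt (𝓡 n) x₀).symm
      (extChartAt (𝓡 n) x₀).target := contMDiffOn_extChartAt_symm x₀
    have h2 := h1.contMDiffOn_tangentMapWithin (m := 1) (by norm_num; exact ENat.LEInfty.out) hopen.uniqueMDiffOn
    let s : EuclideanSpace ℝ (Fin n) → TangentBundle (𝓡 n) (EuclideanSpace ℝ (Fin n)) :=
      fun y ↦ ⟨y, (EuclideanSpace.single l (1 : ℝ) : EuclideanSpace ℝ (Fin n))⟩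
    have h3 : ContMDiff (𝓡 n) (𝓡 n).tangent 1 s := fun y ↦
      contMDiffAt_vectorSpace_iff_contDiffAt.2 contDiffAt_const
    refine (h2.comp h3.contMDiffOn fun y hy ↦ hy).congr fun y hy ↦ ?_
    simp only [Function.comp_apply, tangentMapWithin, s, coordVector]
    rw [mfderivWithin_of_isOpen hopen hy]
  have := (hsec i).inner_bundle (hsec j)
  exact contMDiffOn_iff_contDiffOn.1 this

end Chart

theorem contDiffOn_comp_extChartAt_symm {n : ℕ} {M : Type u} [TopologicalSpace M]
    [ChartedSpace (EuclideanSpace ℝ (Fin n)) M] [IsManifold (𝓡 n) ∞ M] {f : M → ℝ}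
    (hf : ContMDiff (𝓡 n) 𝓘(ℝ, ℝ) 2 f) (x₀ : M) :
    ContDiffOn ℝ 2 (f ∘ (extChartAt (𝓡 n) x₀).symm) (extChartAt (𝓡 n) x₀).target := by
  have : IsManifold (𝓡 n) 2 M := IsManifold.of_le (n := ∞) ENat.LEInfty.out
  exact contMDiffOn_iff_contDiffOn.1 (hf.comp_contMDiffOn (contMDiffOn_extChartAt_symm x₀))

section ChartGradient

variable {n : ℕ} {M : Type u} [TopologicalSpace M] [ChartedSpace (EuclideanSpace ℝ (Fin n)) M]
  [RiemannianBundle (fun x : M ↦ TangentSpace (𝓡 n) x)]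

/-- The components of the gradient of `f` in the chart around `x₀`. -/
noncomputable def chartGradient (f : M → ℝ) (x₀ : M) (y : EuclideanSpace ℝ (Fin n)) :
    EuclideanSpace ℝ (Fin n) :=
  chartDeriv x₀ y (riemannianGradient n f ((extChartAt (𝓡 n) x₀).symm y))

theorem chartGradient_extChartAt (f : M → ℝ) {x₀ p : M} (hp : p ∈ (extChartAt (𝓡 n) x₀).source) :
    chartGradient f x₀ (extChartAt (𝓡 n) x₀ p) =
      mfderiv (𝓡 n) (𝓡 n) (extChartAt (𝓡 n) x₀) p (riemannianGradient n f p) := by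
  have : ∀ q, q = p → (mfderiv (𝓡 n) (𝓡 n) (extChartAt (𝓡 n) x₀) q (riemannianGradient n f q) :
      EuclideanSpace ℝ (Fin n)) =
      mfderiv (𝓡 n) (𝓡 n) (extChartAt (𝓡 n) x₀) p (riemannianGradient n f p) := by
    rintro _ rfl; rfl
  exact this _ ((extChartAt (𝓡 n) x₀).left_inv hp)

theorem inner_riemannianGradient (f : M → ℝ) (x : M) (v : TangentSpace (𝓡 n) x) :
    ⟪riemannianGradient n f x, v⟫_ℝ = mvfderiv (𝓡 n) f x v := by
  simp [riemannianGradient]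

variable [IsManifold (𝓡 n) ∞ M] {f : M → ℝ}

theorem chartInvDeriv_chartGradient {x₀ : M} {y : EuclideanSpace ℝ (Fin n)}
    (hy : y ∈ (extChartAt (𝓡 n) x₀).target) :
    chartInvDeriv x₀ y (chartGradient f x₀ y) =
      riemannianGradient n f ((extChartAt (𝓡 n) x₀).symm y) :=
  chartInvDeriv_chartDeriv hy _

theorem norm_riemannianGradient_sq {x₀ : M} {y : EuclideanSpace ℝ (Fin n)}
    (hy : y ∈ (extChartAt (𝓡 n) x₀).target) :
    ‖riemannianGradient n f ((extChartAt (𝓡 n) x₀).symm y)‖ ^ 2 =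
      ∑ i, ∑ j, metricMatrix n x₀ y i j * (chartGradient f x₀ y i * chartGradient f x₀ y j) := by
  rw [← inner_chartInvDeriv, chartInvDeriv_chartGradient hy, real_inner_self_eq_norm_sq]

theorem inner_chartGradient (hf : ContMDiff (𝓡 n) 𝓘(ℝ, ℝ) 2 f) {x₀ : M}
    {y : EuclideanSpace ℝ (Fin n)} (hy : y ∈ (extChartAt (𝓡 n) x₀).target)
    (v : EuclideanSpace ℝ (Fin n)) :
    ⟪riemannianGradient n f ((extChartAt (𝓡 n) x₀).symm y), chartInvDeriv x₀ y v⟫_ℝ =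
      fderiv ℝ (f ∘ (extChartAt (𝓡 n) x₀).symm) y v := by
  have : IsManifold (𝓡 n) 1 M := IsManifold.of_le (n := ∞) (by norm_num)
  rw [inner_riemannianGradient, ← mfderiv_eq_fderiv]
  have h1 : MDifferentiableAt (𝓡 n) (𝓡 n) (extChartAt (𝓡 n) x₀).symm y :=
    (mdifferentiableOn_extChartAt_symm y hy).mdifferentiableAt
      ((isOpen_extChartAt_target x₀).mem_nhds hy)
  have h2 : MDifferentiableAt (𝓡 n) 𝓘(ℝ, ℝ) f ((extChartAt (𝓡 n) x₀).symm y) :=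
    hf.mdifferentiable two_ne_zero _
  rw [mfderiv_comp y h2 h1]
  rfl

theorem sum_metricMatrix_mul_chartGradient (hf : ContMDiff (𝓡 n) 𝓘(ℝ, ℝ) 2 f) {x₀ : M}
    {y : EuclideanSpace ℝ (Fin n)} (hy : y ∈ (extChartAt (𝓡 n) x₀).target) (l : Fin n) :
    ∑ k, metricMatrix n x₀ y l k * chartGradient f x₀ y k =
      fderiv ℝ (f ∘ (extChartAt (𝓡 n) x₀).symm) y (EuclideanSpace.single l (1 : ℝ)) := by
  rw [← inner_chartGradient hf hy, ← chartInvDeriv_chartGradient hy, real_inner_comm,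
    inner_chartInvDeriv]
  symm
  rw [Finset.sum_eq_single l (by intro b _ hb; simp [hb]) (by simp)]
  simp

variable [IsContMDiffRiemannianBundle (𝓡 n) ∞ (EuclideanSpace ℝ (Fin n))
  (fun x : M ↦ TangentSpace (𝓡 n) x)]

theorem contDiffOn_chartGradient (hf : ContMDiff (𝓡 n) 𝓘(ℝ, ℝ) 2 f) (x₀ : M) :
    ContDiffOn ℝ 1 (chartGradient f x₀) (extChartAt (𝓡 n) x₀).target := by
  have hopen : IsOpen (extChartAt (𝓡 n) x₀).target := isOpen_extChartAt_target x₀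
  rw [contDiffOn_euclidean]
  intro i
  have hdF := (contDiffOn_comp_extChartAt_symm hf x₀).fderiv_of_isOpen (m := 1) hopen
    (by norm_num)
  have h1 : ContDiffOn ℝ 1 (fun y ↦ ∑ l, (metricMatrix n x₀ y)⁻¹ i l *
      fderiv ℝ (f ∘ (extChartAt (𝓡 n) x₀).symm) y (EuclideanSpace.single l (1 : ℝ)))
      (extChartAt (𝓡 n) x₀).target :=
    ContDiffOn.sum fun l _ ↦ (ContDiffOn.matrix_inv_apply (contDiffOn_metricMatrix x₀)
      (fun y hy ↦ isUnit_det_metricMatrix hy) i l).mul (hdF.clm_apply contDiffOn_const)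
  refine h1.congr fun y hy ↦ ?_
  simp_rw [← sum_metricMatrix_mul_chartGradient hf hy]
  have : ((metricMatrix n x₀ y)⁻¹.mulVec
      ((metricMatrix n x₀ y).mulVec (chartGradient f x₀ y))) i = chartGradient f x₀ y i := by
    rw [Matrix.mulVec_mulVec, Matrix.nonsing_inv_mul _ (isUnit_det_metricMatrix hy),
      Matrix.one_mulVec]
  simpa only [Matrix.mulVec, dotProduct] using this.symm

theorem contDiffOn_norm_riemannianGradient_sq (hf : ContMDiff (𝓡 n) 𝓘(ℝ, ℝ) 2 f) (x₀ : M) :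
    ContDiffOn ℝ 1 (fun y ↦ ‖riemannianGradient n f ((extChartAt (𝓡 n) x₀).symm y)‖ ^ 2)
      (extChartAt (𝓡 n) x₀).target := by
  have hX := contDiffOn_euclidean.1 (contDiffOn_chartGradient hf x₀)
  refine ContDiffOn.congr (ContDiffOn.sum (s := Finset.univ) fun i _ ↦
    ContDiffOn.sum (s := Finset.univ) fun j _ ↦
    (contDiffOn_metricMatrix x₀ i j).mul ((hX i).mul (hX j)))
    fun y hy ↦ norm_riemannianGradient_sq hy

/-- At a regular point of a metric function, `d(|grad f|²)` is a multiple of `df`. -/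
theorem IsMetricFunction.fderiv_norm_gradient_sq (hf : IsMetricFunction n f) {x₀ : M}
    {y : EuclideanSpace ℝ (Fin n)} (hy : y ∈ (extChartAt (𝓡 n) x₀).target)
    (hne : riemannianGradient n f ((extChartAt (𝓡 n) x₀).symm y) ≠ 0) :
    ∃ r : ℝ, fderiv ℝ
      (fun z ↦ ‖riemannianGradient n f ((extChartAt (𝓡 n) x₀).symm z)‖ ^ 2) y =
      r • fderiv ℝ (f ∘ (extChartAt (𝓡 n) x₀).symm) y := by
  have hnhds : (extChartAt (𝓡 n) x₀).target ∈ nhds y := (isOpen_extChartAt_target x₀).mem_nhds hy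
  have hF := (contDiffOn_comp_extChartAt_symm hf.contMDiff x₀).contDiffAt hnhds
  have hne' : fderiv ℝ (f ∘ (extChartAt (𝓡 n) x₀).symm) y ≠ 0 := by
    intro h0
    have h1 := inner_chartGradient hf.contMDiff hy (chartGradient f x₀ y)
    rw [chartInvDeriv_chartGradient hy, h0] at h1
    exact hne (inner_self_eq_zero.1 h1)
  refine ContinuousLinearMap.eq_smul_of_ker_le hne' fun v hv ↦ ?_
  obtain ⟨δ, hδ, c, hc, hc0, hcv, hlevel⟩ :=
    (hF.hasStrictFDerivAt two_ne_zero).exists_curve_in_level hne' hnhds hv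
  have hW := ((contDiffOn_norm_riemannianGradient_sq hf.contMDiff x₀).contDiffAt
    hnhds).differentiableAt one_ne_zero
  have h1 : HasDerivAt (fun s ↦ ‖riemannianGradient n f ((extChartAt (𝓡 n) x₀).symm (c s))‖ ^ 2)
      (fderiv ℝ (fun z ↦ ‖riemannianGradient n f ((extChartAt (𝓡 n) x₀).symm z)‖ ^ 2) y v) 0 := by
    subst hc0
    exact hW.hasFDerivAt.comp_hasDerivAt (0 : ℝ) hcv
  have hconn : IsPreconnected
      ((fun s ↦ (extChartAt (𝓡 n) x₀).symm (c s)) '' Metric.ball (0 : ℝ) δ) :=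
    (convex_ball (0 : ℝ) δ).isPreconnected.image _
      ((continuousOn_extChartAt_symm x₀).comp hc fun s hs ↦ (hlevel s hs).2)
  have hsub := hconn.subset_connectedComponentIn
    (F := f ⁻¹' {f ((extChartAt (𝓡 n) x₀).symm y)})
    (x := (extChartAt (𝓡 n) x₀).symm y)
    ⟨0, Metric.mem_ball_self hδ, by simp only [hc0]⟩
    (by rintro _ ⟨s, hs, rfl⟩; exact (hlevel s hs).1)
  refine h1.unique ((hasDerivAt_const (0 : ℝ)
    (‖riemannianGradient n f ((extChartAt (𝓡 n) x₀).symm y)‖ ^ 2)).congr_of_eventuallyEq ?_)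
  filter_upwards [Metric.ball_mem_nhds (0 : ℝ) hδ] with s hs
  rw [hf.norm_gradient_eq _ _ (hsub ⟨s, hs, rfl⟩)]

end ChartGradient

section GradientLine

open Filter Topology

variable {n : ℕ} {M : Type u} [TopologicalSpace M] [ChartedSpace (EuclideanSpace ℝ (Fin n)) M]
  [RiemannianBundle (fun x : M ↦ TangentSpace (𝓡 n) x)] {f : M → ℝ} {γ : ℝ → M} {J : Set ℝ}

theorem IsGradientLineOn.continuousAt (hγ : IsGradientLineOn n f γ J) {t : ℝ} (ht : t ∈ J) :
    ContinuousAt γ t :=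
  ((hγ.isMIntegralCurveOn t ht).hasMFDerivAt (hγ.isOpen.mem_nhds ht)).continuousAt

theorem IsGradientLineOn.isOpen_inter_preimage_source (hγ : IsGradientLineOn n f γ J) (x₀ : M) :
    IsOpen (J ∩ γ ⁻¹' (extChartAt (𝓡 n) x₀).source) :=
  ContinuousOn.isOpen_inter_preimage (fun _ ht ↦ (hγ.continuousAt ht).continuousWithinAt)
    hγ.isOpen (isOpen_extChartAt_source x₀)

variable [IsManifold (𝓡 n) ∞ M]

theorem IsGradientLineOn.hasDerivAt_extChartAt (hγ : IsGradientLineOn n f γ J) {x₀ : M} {t : ℝ}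
    (ht : t ∈ J ∩ γ ⁻¹' (extChartAt (𝓡 n) x₀).source) :
    HasDerivAt (fun t ↦ extChartAt (𝓡 n) x₀ (γ t))
      (chartGradient f x₀ (extChartAt (𝓡 n) x₀ (γ t))) t := by
  have : IsManifold (𝓡 n) 1 M := IsManifold.of_le (n := ∞) (by norm_num)
  have h1 := (hγ.isMIntegralCurveOn t ht.1).hasMFDerivAt (hγ.isOpen.mem_nhds ht.1)
  have h2 : MDifferentiableAt (𝓡 n) (𝓡 n) (extChartAt (𝓡 n) x₀) (γ t) :=
    mdifferentiableAt_extChartAt (by simpa using ht.2)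
  let A : TangentSpace (𝓡 n) (γ t) →L[ℝ] EuclideanSpace ℝ (Fin n) :=
    mfderiv (𝓡 n) (𝓡 n) (extChartAt (𝓡 n) x₀) (γ t)
  let L : ℝ →L[ℝ] EuclideanSpace ℝ (Fin n) :=
    A.comp ((1 : ℝ →L[ℝ] ℝ).smulRight (riemannianGradient n f (γ t)))
  have h3 : HasFDerivAt (fun t ↦ extChartAt (𝓡 n) x₀ (γ t)) L t :=
    (h2.hasMFDerivAt.comp t h1).hasFDerivAt
  have hL : L 1 = A (riemannianGradient n f (γ t)) := by
    change A ((1 : ℝ) • riemannianGradient n f (γ t)) = _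
    rw [one_smul]
  rw [chartGradient_extChartAt f ht.2]
  exact hL ▸ h3.hasDerivAt

variable [IsContMDiffRiemannianBundle (𝓡 n) ∞ (EuclideanSpace ℝ (Fin n))
  (fun x : M ↦ TangentSpace (𝓡 n) x)]

theorem IsGradientLineOn.contDiffOn_extChartAt (hγ : IsGradientLineOn n f γ J)
    (hf : ContMDiff (𝓡 n) 𝓘(ℝ, ℝ) 2 f) (x₀ : M) :
    ContDiffOn ℝ 2 (fun t ↦ extChartAt (𝓡 n) x₀ (γ t))
      (J ∩ γ ⁻¹' (extChartAt (𝓡 n) x₀).source) := by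
  have hV := hγ.isOpen_inter_preimage_source x₀
  have hmaps : MapsTo (fun t ↦ extChartAt (𝓡 n) x₀ (γ t))
      (J ∩ γ ⁻¹' (extChartAt (𝓡 n) x₀).source) (extChartAt (𝓡 n) x₀).target :=
    fun t ht ↦ (extChartAt (𝓡 n) x₀).map_source ht.2
  have hd : DifferentiableOn ℝ (fun t ↦ extChartAt (𝓡 n) x₀ (γ t))
      (J ∩ γ ⁻¹' (extChartAt (𝓡 n) x₀).source) := fun t ht ↦
    (hγ.hasDerivAt_extChartAt ht).differentiableAt.differentiableWithinAt
  have hX := contDiffOn_chartGradient hf x₀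
  have h1 : ContDiffOn ℝ 1 (fun t ↦ extChartAt (𝓡 n) x₀ (γ t))
      (J ∩ γ ⁻¹' (extChartAt (𝓡 n) x₀).source) := by
    rw [show (1 : WithTop ℕ∞) = 0 + 1 by simp, contDiffOn_succ_iff_deriv_of_isOpen hV]
    refine ⟨hd, by simp, ?_⟩
    rw [contDiffOn_zero]
    exact (hX.continuousOn.comp hd.continuousOn hmaps).congr
      fun t ht ↦ (hγ.hasDerivAt_extChartAt ht).deriv
  rw [show (2 : WithTop ℕ∞) = 1 + 1 by norm_num, contDiffOn_succ_iff_deriv_of_isOpen hV]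
  exact ⟨hd, by simp, (hX.comp h1 hmaps).congr fun t ht ↦ (hγ.hasDerivAt_extChartAt ht).deriv⟩

theorem IsGradientLineOn.contMDiffOn (hγ : IsGradientLineOn n f γ J)
    (hf : ContMDiff (𝓡 n) 𝓘(ℝ, ℝ) 2 f) : ContMDiffOn 𝓘(ℝ, ℝ) (𝓡 n) 2 γ J := by
  intro t ht
  refine ContMDiffAt.contMDiffWithinAt (contMDiffAt_iff_target.2 ⟨hγ.continuousAt ht, ?_⟩)
  exact ((hγ.contDiffOn_extChartAt hf (γ t)).contDiffAt
    ((hγ.isOpen_inter_preimage_source (γ t)).mem_nhds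
      ⟨ht, mem_extChartAt_source (γ t)⟩)).contMDiffAt

theorem IsGradientLineOn.contDiffOn_norm_sq (hγ : IsGradientLineOn n f γ J)
    (hf : ContMDiff (𝓡 n) 𝓘(ℝ, ℝ) 2 f) :
    ContDiffOn ℝ 1 (fun t ↦ ‖riemannianGradient n f (γ t)‖ ^ 2) J := by
  intro t ht
  have hV := (hγ.isOpen_inter_preimage_source (γ t)).mem_nhds ⟨ht, mem_extChartAt_source (γ t)⟩
  have h1 := ((contDiffOn_norm_riemannianGradient_sq hf (γ t)).comp
    ((hγ.contDiffOn_extChartAt hf (γ t)).of_le one_le_two)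
    fun s hs ↦ (extChartAt (𝓡 n) (γ t)).map_source hs.2).contDiffAt hV
  refine (h1.congr_of_eventuallyEq ?_).contDiffWithinAt
  filter_upwards [hV] with s hs
  simp only [Function.comp_apply]
  rw [(extChartAt (𝓡 n) (γ t)).left_inv hs.2]

/-- A gradient line through a critical point is locally constant. -/
theorem IsGradientLineOn.eventually_eq_of_gradient_eq_zero (hγ : IsGradientLineOn n f γ J)
    (hf : ContMDiff (𝓡 n) 𝓘(ℝ, ℝ) 2 f) {t₀ : ℝ} (ht₀ : t₀ ∈ J)
    (h0 : riemannianGradient n f (γ t₀) = 0) : ∀ᶠ t in 𝓝 t₀, γ t = γ t₀ := by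
  set x₀ := γ t₀
  have hsrc : x₀ ∈ (extChartAt (𝓡 n) x₀).source := mem_extChartAt_source x₀
  have hV := (hγ.isOpen_inter_preimage_source x₀).mem_nhds (show t₀ ∈ _ from ⟨ht₀, hsrc⟩)
  have hX0 : chartGradient f x₀ (extChartAt (𝓡 n) x₀ x₀) = 0 := by
    rw [chartGradient_extChartAt f hsrc, h0, map_zero]; rfl
  obtain ⟨K, s, hs, hLip⟩ := ((contDiffOn_chartGradient hf x₀).contDiffAt
    ((isOpen_extChartAt_target x₀).mem_nhds
      ((extChartAt (𝓡 n) x₀).map_source hsrc))).exists_lipschitzOnWith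
  have hcont : ContinuousAt (fun t ↦ extChartAt (𝓡 n) x₀ (γ t)) t₀ :=
    (hγ.hasDerivAt_extChartAt (x₀ := x₀) ⟨ht₀, hsrc⟩).continuousAt
  have key : (fun t ↦ extChartAt (𝓡 n) x₀ (γ t)) =ᶠ[𝓝 t₀] fun _ ↦ extChartAt (𝓡 n) x₀ x₀ := by
    refine ODE_solution_unique_of_eventually (v := fun _ ↦ chartGradient f x₀) (s := fun _ ↦ s)
      (K := K) (Eventually.of_forall fun _ ↦ hLip) ?_ ?_ rfl
    · filter_upwards [hV, hcont hs] with t ht hts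
      exact ⟨hγ.hasDerivAt_extChartAt ht, hts⟩
    · refine Eventually.of_forall fun t ↦ ⟨?_, mem_of_mem_nhds hs⟩
      rw [hX0]
      exact hasDerivAt_const _ _
  filter_upwards [key, hV] with t ht htV
  exact (extChartAt (𝓡 n) x₀).injOn htV.2 hsrc ht

theorem IsGradientLineOn.gradient_eq_zero_or_ne_zero (hγ : IsGradientLineOn n f γ J)
    (hf : ContMDiff (𝓡 n) 𝓘(ℝ, ℝ) 2 f) :
    (∀ t ∈ J, riemannianGradient n f (γ t) = 0) ∨
      ∀ t ∈ J, riemannianGradient n f (γ t) ≠ 0 := by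
  let u := {t ∈ J | riemannianGradient n f (γ t) = 0}
  let v := {t ∈ J | riemannianGradient n f (γ t) ≠ 0}
  have hu : IsOpen u := by
    rw [isOpen_iff_mem_nhds]
    rintro t ⟨ht, ht0⟩
    filter_upwards [hγ.isOpen.mem_nhds ht, hγ.eventually_eq_of_gradient_eq_zero hf ht ht0]
      with s hs hst
    exact ⟨hs, by rw [hst, ht0]⟩
  have hv : IsOpen v := by
    convert (hγ.contDiffOn_norm_sq hf).continuousOn.isOpen_inter_preimage hγ.isOpen
      (isOpen_compl_singleton (x := (0 : ℝ))) using 1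
    ext t
    simp [v]
  have huv : Disjoint u v := Set.disjoint_left.2 fun t h1 h2 ↦ h2.2 h1.2
  have hsub : J ⊆ u ∪ v := fun t ht ↦ by
    by_cases h : riemannianGradient n f (γ t) = 0
    exacts [Or.inl ⟨ht, h⟩, Or.inr ⟨ht, h⟩]
  rcases hγ.ordConnected.isPreconnected.subset_or_subset hu hv huv hsub with h | h
  · exact Or.inl fun t ht ↦ (h ht).2
  · exact Or.inr fun t ht ↦ (h ht).2

/-- The covariant acceleration of a regular gradient line of a metric function is the logarithmic
derivative of its speed times its velocity. -/
theorem IsGradientLineOn.exists_acceleration_eq (hγ : IsGradientLineOn n f γ J)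
    (hf : IsMetricFunction n f) {x₀ : M} {t : ℝ}
    (ht : t ∈ J ∩ γ ⁻¹' (extChartAt (𝓡 n) x₀).source)
    (hne : riemannianGradient n f (γ t) ≠ 0) :
    ∃ r : ℝ, HasDerivAt (fun s ↦ ‖riemannianGradient n f (γ s)‖)
        (r * ‖riemannianGradient n f (γ t)‖) t ∧
      ∀ k, deriv (deriv (coords n x₀ γ k)) t +
        ∑ i, ∑ j, christoffel n x₀ k i j (extChartAt (𝓡 n) x₀ (γ t)) *
          deriv (coords n x₀ γ i) t * deriv (coords n x₀ γ j) t =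
        r * deriv (coords n x₀ γ k) t := by
  have hopen : IsOpen (extChartAt (𝓡 n) x₀).target := isOpen_extChartAt_target x₀
  have hy : extChartAt (𝓡 n) x₀ (γ t) ∈ (extChartAt (𝓡 n) x₀).target :=
    (extChartAt (𝓡 n) x₀).map_source ht.2
  have hleft := (extChartAt (𝓡 n) x₀).left_inv ht.2
  have hV := (hγ.isOpen_inter_preimage_source x₀).mem_nhds ht
  obtain ⟨r, hr⟩ := hf.fderiv_norm_gradient_sq hy (by rwa [hleft])
  refine ⟨r / 2, ?_, ?_⟩
  · have hW := ((contDiffOn_norm_riemannianGradient_sq hf.contMDiff x₀).contDiffAt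
      (hopen.mem_nhds hy)).differentiableAt one_ne_zero
    have h1 := hW.hasFDerivAt.comp_hasDerivAt t (hγ.hasDerivAt_extChartAt ht)
    have h2 := inner_chartGradient hf.contMDiff hy
      (chartGradient f x₀ (extChartAt (𝓡 n) x₀ (γ t)))
    rw [chartInvDeriv_chartGradient hy, real_inner_self_eq_norm_sq, hleft] at h2
    rw [hr, smul_apply, ← h2, smul_eq_mul] at h1
    have h3 : HasDerivAt (fun s ↦ ‖riemannianGradient n f (γ s)‖ ^ 2)
        (r * ‖riemannianGradient n f (γ t)‖ ^ 2) t := by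
      refine h1.congr_of_eventuallyEq ?_
      filter_upwards [hV] with s hs
      simp only [Function.comp_apply]
      rw [(extChartAt (𝓡 n) x₀).left_inv hs.2]
    have hpos : 0 < ‖riemannianGradient n f (γ t)‖ := norm_pos_iff.2 hne
    have h4 := h3.sqrt (by positivity)
    simp only [Real.sqrt_sq (norm_nonneg _)] at h4
    convert! h4 using 1
    field_simp
  · exact gradient_acceleration hopen (contDiffOn_comp_extChartAt_symm hf.contMDiff x₀)
      (contDiffOn_metricMatrix x₀) (metricMatrix_symm x₀)
      (fun y hy ↦ isUnit_det_metricMatrix hy) (contDiffOn_chartGradient hf.contMDiff x₀)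
      (fun y hy ↦ sum_metricMatrix_mul_chartGradient hf.contMDiff hy)
      (fun y hy ↦ norm_riemannianGradient_sq hy)
      (x := fun s ↦ extChartAt (𝓡 n) x₀ (γ s))
      (by filter_upwards [hV] with s hs using hγ.hasDerivAt_extChartAt hs) hy hr

end GradientLine

section Geodesic

open Filter Topology

variable {n : ℕ} {M : Type u} [TopologicalSpace M] [ChartedSpace (EuclideanSpace ℝ (Fin n)) M]
  [RiemannianBundle (fun x : M ↦ TangentSpace (𝓡 n) x)]

theorem isGeodesicOn_of_locally_constant {c : ℝ → M} {J : Set ℝ} (hJ : IsOpen J)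
    (hJc : J.OrdConnected) (hc : ∀ t ∈ J, ∀ᶠ s in 𝓝 t, c s = c t) : IsGeodesicOn n c J where
  isOpen := hJ
  ordConnected := hJc
  contMDiffOn t ht := (contMDiffAt_const.congr_of_eventuallyEq (hc t ht)).contMDiffWithinAt
  geodesic_eq x₀ t ht _ k := by
    have h : ∀ i, coords n x₀ c i =ᶠ[𝓝 t] fun _ ↦ coords n x₀ c i t := fun i ↦ by
      filter_upwards [hc t ht] with s hs
      simp only [coords, hs]
    have h0 : ∀ i, deriv (coords n x₀ c i) =ᶠ[𝓝 t] fun _ ↦ 0 := fun i ↦ by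
      filter_upwards [(h i).deriv] with s hs
      rw [hs, deriv_const]
    simp [(h0 _).deriv_eq, (h0 _).self_of_nhds]

variable [IsManifold (𝓡 n) ∞ M]
  [IsContMDiffRiemannianBundle (𝓡 n) ∞ (EuclideanSpace ℝ (Fin n))
    (fun x : M ↦ TangentSpace (𝓡 n) x)]

/-- Gradient lines of metric functions are geodesic lines. -/
theorem IsGradientLineOn.isGeodesicLineOn {f : M → ℝ} {γ : ℝ → M} {J : Set ℝ}
    (hγ : IsGradientLineOn n f γ J) (hf : IsMetricFunction n f) : IsGeodesicLineOn n γ J := by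
  rcases hγ.gradient_eq_zero_or_ne_zero hf.contMDiff with h0 | hne
  · exact ⟨γ, J, id, isGeodesicOn_of_locally_constant hγ.isOpen hγ.ordConnected fun t ht ↦
      hγ.eventually_eq_of_gradient_eq_zero hf.contMDiff ht (h0 t ht), contDiffOn_id, by simp,
      bijOn_id J, fun _ _ ↦ rfl⟩
  let w : ℝ → ℝ := fun t ↦ ‖riemannianGradient n f (γ t)‖
  have hpos : ∀ t ∈ J, 0 < w t := fun t ht ↦ norm_pos_iff.2 (hne t ht)
  have hw : ContDiffOn ℝ 1 w J := by
    have h := (hγ.contDiffOn_norm_sq hf.contMDiff).sqrt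
      fun t ht ↦ (pow_pos (hpos t ht) 2).ne'
    simpa only [Real.sqrt_sq (norm_nonneg _)] using h
  obtain ⟨φ, ψ, J', hJ', hJ'c, hbij, hinv, hφ, hφ2, hψ, hψ2⟩ :=
    exists_reparametrization hγ.isOpen hγ.ordConnected hw hpos
  have hψmem : MapsTo ψ J' J := fun s hs ↦ by
    obtain ⟨t, ht, rfl⟩ := hbij.surjOn hs
    rwa [hinv.1 ht]
  refine ⟨γ ∘ ψ, J', φ, ⟨hJ', hJ'c, ?_, ?_⟩, hφ2, fun t ht ↦ ?_, hbij, fun t ht ↦ ?_⟩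
  · exact (hγ.contMDiffOn hf.contMDiff).comp hψ2.contMDiffOn hψmem
  · intro x₀ s hs hsrc k
    have ht : ψ s ∈ J ∩ γ ⁻¹' (extChartAt (𝓡 n) x₀).source := ⟨hψmem hs, hsrc⟩
    obtain ⟨r, hr, hacc⟩ := hγ.exists_acceleration_eq hf ht (hne _ ht.1)
    have hx := hγ.contDiffOn_extChartAt hf.contMDiff x₀
    have hV := hγ.isOpen_inter_preimage_source x₀
    have hcoord : ∀ i, ContDiffOn ℝ 2 (coords n x₀ γ i)
      (J ∩ γ ⁻¹' (extChartAt (𝓡 n) x₀).source) := contDiffOn_euclidean.1 hx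
    have hd : ∀ i, ∀ t ∈ J ∩ γ ⁻¹' (extChartAt (𝓡 n) x₀).source,
        HasDerivAt (coords n x₀ γ i) (deriv (coords n x₀ γ i) t) t := fun i t ht ↦
      (((hcoord i).contDiffAt (hV.mem_nhds ht)).differentiableAt two_ne_zero).hasDerivAt
    have hdd : ∀ i, HasDerivAt (deriv (coords n x₀ γ i))
        (deriv (deriv (coords n x₀ γ i)) (ψ s)) (ψ s) := fun i ↦
      ((((hcoord i).deriv_of_isOpen (m := 1) hV (by norm_num)).contDiffAt
        (hV.mem_nhds ht)).differentiableAt one_ne_zero).hasDerivAt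
    have hev : ∀ i, deriv (coords n x₀ (γ ∘ ψ) i) =ᶠ[𝓝 s]
        fun s ↦ deriv (coords n x₀ γ i) (ψ s) * (w (ψ s))⁻¹ := fun i ↦ by
      filter_upwards [hJ'.mem_nhds hs, (hψ s hs).continuousAt (hV.mem_nhds ht)] with s' hs' hs'V
      exact ((hd i (ψ s') hs'V).comp s' (hψ s' hs')).deriv
    have hw0 : w (ψ s) ≠ 0 := (hpos _ ht.1).ne'
    have h2 : deriv (deriv (coords n x₀ (γ ∘ ψ) k)) s =
        deriv (deriv (coords n x₀ γ k)) (ψ s) * (w (ψ s))⁻¹ ^ 2 -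
          r * deriv (coords n x₀ γ k) (ψ s) * (w (ψ s))⁻¹ ^ 2 := by
      rw [(hev k).deriv_eq]
      have hr' : HasDerivAt w (r * w (ψ s)) (ψ s) := hr
      have h3 := ((hdd k).comp s (hψ s hs)).mul ((hr'.comp s (hψ s hs)).inv hw0)
      refine Eq.trans h3.deriv ?_
      simp only [Function.comp_apply, Pi.inv_apply]
      field_simp
      ring
    have h4 := hacc k
    rw [h2]
    simp only [(hev _).self_of_nhds, Function.comp_apply]
    rw [← h4]
    simp only [add_mul, Finset.sum_mul]
    rw [sub_add_eq_add_sub, sub_eq_zero, add_right_inj]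
    refine Finset.sum_congr rfl fun i _ ↦ Finset.sum_congr rfl fun j _ ↦ by ring
  · rw [(hφ t ht).deriv]
    exact hpos t ht
  · simp only [Function.comp_apply, hinv.1 ht]

end Geodesic

section Euclidean

variable {n : ℕ}

theorem christoffel_euclideanSpace (x₀ : EuclideanSpace ℝ (Fin n)) (k i j : Fin n)
    (y : EuclideanSpace ℝ (Fin n)) : christoffel n x₀ k i j y = 0 := by
  have h : ∀ i j, (fun z ↦ metricMatrix n x₀ z i j) =
      fun _ ↦ ⟪(EuclideanSpace.single i (1 : ℝ) : EuclideanSpace ℝ (Fin n)),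
        (EuclideanSpace.single j (1 : ℝ) : EuclideanSpace ℝ (Fin n))⟫_ℝ := by
    intro i j
    funext z
    have hc : ∀ l, (coordVector n x₀ l z : EuclideanSpace ℝ (Fin n)) =
        EuclideanSpace.single l (1 : ℝ) := by
      intro l
      have he : ∀ p, (extChartAt (𝓡 n) x₀).symm p = p := fun _ ↦ rfl
      have hd := (hasMFDerivAt_id (I := 𝓡 n) z).congr_of_eventuallyEq
        (Filter.Eventually.of_forall he)
      exact congrArg (fun A : EuclideanSpace ℝ (Fin n) →L[ℝ] EuclideanSpace ℝ (Fin n) ↦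
        A (EuclideanSpace.single l (1 : ℝ))) hd.mfderiv
    simp only [metricMatrix, Matrix.of_apply]
    rw [← hc i, ← hc j]
    rfl
  simp [christoffel, metricPartial, h]

theorem IsGeodesicLineOn.euclideanCurvature_eq_zero {γ : ℝ → EuclideanSpace ℝ (Fin n)} {J : Set ℝ}
    (hJ : IsOpen J) (hγ : IsGeodesicLineOn n γ J) {t : ℝ} (ht : t ∈ J) :
    euclideanCurvature γ t = 0 := by
  obtain ⟨c, J', φ, hc, hφ, hφ', hbij, hγc⟩ := hγ
  have hc2 : ContDiffOn ℝ 2 c J' := contMDiffOn_iff_contDiffOn.1 hc.contMDiffOn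
  have hdc : ContDiffOn ℝ 1 (deriv c) J' := hc2.deriv_of_isOpen hc.isOpen (by norm_num)
  have hcd : ∀ s ∈ J', HasDerivAt c (deriv c s) s := fun s hs ↦
    ((hc2.contDiffAt (hc.isOpen.mem_nhds hs)).differentiableAt two_ne_zero).hasDerivAt
  have hcoord : ∀ i, ∀ {z : ℝ → EuclideanSpace ℝ (Fin n)} {z' : EuclideanSpace ℝ (Fin n)} {t : ℝ},
      HasDerivAt z z' t → HasDerivAt (fun t ↦ z t i) (z' i) t := fun i z z' t h ↦
    (EuclideanSpace.proj (𝕜 := ℝ) i).hasFDerivAt.comp_hasDerivAt t h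
  have hddc : ∀ s ∈ J', deriv (deriv c) s = 0 := by
    intro s hs
    ext k
    have h1 := hc.geodesic_eq (c s) s hs (mem_extChartAt_source _) k
    simp only [christoffel_euclideanSpace, zero_mul, Finset.sum_const_zero, add_zero] at h1
    have h2 : deriv (coords n (c s) c k) =ᶠ[nhds s] fun s ↦ deriv c s k := by
      filter_upwards [hc.isOpen.mem_nhds hs] with r hr
      exact (hcoord k (hcd r hr)).deriv
    have h3 := (((hdc.contDiffAt (hc.isOpen.mem_nhds hs)).differentiableAt
      one_ne_zero).hasDerivAt)
    rw [h2.deriv_eq, (hcoord k h3).deriv] at h1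
    exact h1
  have hconst : ∀ s ∈ J', deriv c s = deriv c (φ t) := fun s hs ↦
    hc.isOpen.is_const_of_deriv_eq_zero hc.ordConnected.isPreconnected
      (hdc.differentiableOn one_ne_zero) hddc hs (hbij.mapsTo ht)
  have hγ' : ∀ s ∈ J, deriv γ s = deriv φ s • deriv c (φ t) := by
    intro s hs
    have h1 : γ =ᶠ[nhds s] c ∘ φ := by
      filter_upwards [hJ.mem_nhds hs] with r hr using hγc r hr
    have h2 := ((hφ.contDiffAt (hJ.mem_nhds hs)).differentiableAt two_ne_zero).hasDerivAt
    rw [h1.deriv_eq, ((hcd _ (hbij.mapsTo hs)).scomp s h2).deriv, hconst _ (hbij.mapsTo hs)]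
  have hT : (fun s ↦ ‖deriv γ s‖⁻¹ • deriv γ s) =ᶠ[nhds t]
      fun _ ↦ ‖deriv c (φ t)‖⁻¹ • deriv c (φ t) := by
    filter_upwards [hJ.mem_nhds ht] with s hs
    have hp := hφ' s hs
    rw [hγ' s hs, norm_smul, Real.norm_of_nonneg hp.le, smul_smul, mul_inv, mul_right_comm,
      inv_mul_cancel₀ hp.ne', one_mul]
  simp only [euclideanCurvature, hT.deriv_eq, deriv_const, norm_zero, zero_div]

end Euclidean

theorem mainTheorem2 (n : ℕ) :
    (∀ (M : Type u) [TopologicalSpace M] [ChartedSpace (EuclideanSpace ℝ (Fin n)) M]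
      [IsManifold (𝓡 n) ∞ M] [RiemannianBundle (fun x : M ↦ TangentSpace (𝓡 n) x)]
      [IsContMDiffRiemannianBundle (𝓡 n) ∞ (EuclideanSpace ℝ (Fin n))
        (fun x : M ↦ TangentSpace (𝓡 n) x)]
      (f : M → ℝ), IsMetricFunction n f →
      ∀ (γ : ℝ → M) (J : Set ℝ), IsGradientLineOn n f γ J → IsGeodesicLineOn n γ J) ∧
    (∀ f : EuclideanSpace ℝ (Fin n) → ℝ, IsMetricFunction n f →
      ∀ (γ : ℝ → EuclideanSpace ℝ (Fin n)) (J : Set ℝ), IsGradientLineOn n f γ J →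
        ∀ t ∈ J, euclideanCurvature γ t = 0) := by
  refine ⟨fun M _ _ _ _ _ f hf γ J hγ ↦ hγ.isGeodesicLineOn hf, fun f hf γ J hγ t ht ↦ ?_⟩
  exact (hγ.isGeodesicLineOn hf).euclideanCurvature_eq_zero hγ.isOpen ht
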